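/- Let $\delta>0$. A geodesic metric space is called $\delta$-hyperbolic if each side of every geodesic triangle lies in the closed $\delta$-neighbourhood of the union of the other two sides. For an isometry $f$ of a metric space $S$ write $\tau(f)=\lim_{n\to\infty} d(x,f^nx)/n$ for its translation length (independent of $x\in S$), and call $x\in S$ \emph{almost minimal} for $f$ if $d(x,fx)-\inf_{z\in S}d(z,fz)\le\delta$. Call a pair of constants $T,K>0$ \emph{admissible} (for $\delta$) if for every nonempty $\delta$-hyperbolic space $S$, every isometry $f$ of $S$ with $\tau(f)\ge T$, every almost minimal point $x$ for $f$ and every integer $i\ge 0$ one has $i\,\tau(f)\le d(x,f^ix)\le i\,\tau(f)+K$. Let a group $\Gamma$ act by isometries on a metric space $S$. For a path $w$ of finite length $|w|$, a real number $0<W<|w|$ and $x,y\in S$ put $$c_{w,W}([x,y])=d(x,y)-\inf_\alpha\bigl(|\alpha|-W|\alpha|_w\bigr),$$ where $\alpha$ ranges over the paths from $x$ to $y$ and $|\alpha|_w$ is the maximal number of non-overlapping subpaths of $\alpha$ that are oriented copies $aw$ ($a\in\Gamma$) of $w$; for $x_0\in S$ and $a\in\Gamma$ put $h_{w,W,x_0}(a)=c_{w,W}([x_0,ax_0])-c_{w^{-1},W}([x_0,ax_0])$,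 where $w^{-1}$ is $w$ traversed backwards. For $f\in\Gamma$ with $\tau(f)\ge 2K+2$, an almost minimal point $x_0$ for $f$ and a geodesic $[x_0,fx_0]$, write $h_f=h_{[x_0,fx_0],\,K+1,\,x_0}$. The homogenization of $\psi:\Gamma\to\mathbb{R}$ is $\overline{\psi}(a)=\lim_{n\to\infty}\psi(a^n)/n$. The action is acylindrical with parameters $R:(0,\infty)\to(0,\infty)$ and $N:(0,\infty)\to\mathbb{Z}_{>0}$ if for all $r>0$ and all $x,x'\in S$ with $d(x,x')\ge R(r)$ there are at most $N(r)$ elements $a\in\Gamma$ with $d(x,ax)\le r$ and $d(x',ax')\le r$. An element $g\in\Gamma$ is loxodromic if $\tau(g)>0$, and chiral if for no integer $m>0$ the element $g^m$ is conjugate to $g^{-m}$. \textbf{Theorem.} Let $\delta>0$. Admissible constants for $\delta$ exist. Fix admissible constants $T,K$. Then for all $R,N$ there is an integer $M>0$, depending only on $\delta$ (with the fixed $T,K$) and on $R,N$, such that for every nonempty $\delta$-hyperbolic space $S$, every group $\Gamma$ acting on $S$ by isometries and acylindrically with parameters $R,N$, and every chiral loxodromic $g\in\Gamma$: one has $\tau(g^M)\ge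 2K+2$, and for every almost minimal point $x_0$ for $g^M$ and every geodesic $[x_0,g^Mx_0]$, the limit defining $\overline{h_{g^M}}(g)$ exists and $$\overline{h_{g^M}}(g)\ \ge\ \frac1M .$$ -/

import Mathlib

open Filter Topology

noncomputable section

namespace AcylGap

universe u v

/-! ### Paths, geodesics, hyperbolic spaces -/

/-- A path of finite length, parametrised by arc length on `[0, len]`: the variation of `toFun` on
each `[s, t] ⊆ [0, len]` is `t - s`. Values of `toFun` outside `[0, len]` are irrelevant. Length,
subpaths and copies of a path do not depend on the parametrisation, so that every path of finite
length is represented. -/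
structure ArcPath (S : Type u) [MetricSpace S] where
  len : ℝ
  len_nonneg : 0 ≤ len
  toFun : ℝ → S
  unitSpeed : HasUnitSpeedOn toFun (Set.Icc 0 len)

namespace ArcPath

variable {S : Type u} [MetricSpace S]

def source (p : ArcPath S) : S := p.toFun 0

def target (p : ArcPath S) : S := p.toFun p.len

def image (p : ArcPath S) : Set S := p.toFun '' Set.Icc 0 p.len

theorem reverse_unitSpeed (p : ArcPath S) :
    HasUnitSpeedOn (fun t => p.toFun (p.len - t)) (Set.Icc 0 p.len) := by
  intro x hx y hy
  have hanti : AntitoneOn (fun t : ℝ => p.len - t) (Set.Icc 0 p.len ∩ Set.Icc x y) :=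
    fun a _ b _ hab => sub_le_sub_left hab _
  have h := eVariationOn.comp_eq_of_antitoneOn p.toFun (fun t : ℝ => p.len - t) hanti
  have himg : (fun t : ℝ => p.len - t) '' (Set.Icc 0 p.len ∩ Set.Icc x y)
      = Set.Icc 0 p.len ∩ Set.Icc (p.len - y) (p.len - x) := by
    rw [Set.Icc_inter_Icc, Set.Icc_inter_Icc, Set.image_const_sub_Icc]
    congr 1
    · rw [min_eq_right hy.2, max_eq_right (by linarith [hy.2])]
    · rw [max_eq_right hx.1, min_eq_right (by linarith [hx.1])]
  rw [himg] at h
  have h' := p.unitSpeed (x := p.len - y) ⟨by linarith [hy.2], by linarith [hy.1]⟩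
    (y := p.len - x) ⟨by linarith [hx.2], by linarith [hx.1]⟩
  have e : (p.len - x) - (p.len - y) = y - x := by ring
  rw [e] at h'
  exact h.trans h'

/-- The path `p` traversed backwards. -/
def reverse (p : ArcPath S) : ArcPath S where
  len := p.len
  len_nonneg := p.len_nonneg
  toFun t := p.toFun (p.len - t)
  unitSpeed := p.reverse_unitSpeed

/-- `p` is a geodesic from `x` to `y`. -/
def IsGeodesic (p : ArcPath S) (x y : S) : Prop :=
  p.source = x ∧ p.target = y ∧
    ∀ s ∈ Set.Icc 0 p.len, ∀ t ∈ Set.Icc 0 p.len, dist (p.toFun s) (p.toFun t) = |s - t|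

end ArcPath

/-- The closed `r`-neighbourhood of a (nonempty) set. -/
def nbhd {S : Type u} [MetricSpace S] (A : Set S) (r : ℝ) : Set S :=
  {x | Metric.infDist x A ≤ r}

/-- `S` is a `δ`-hyperbolic space: a geodesic space all of whose geodesic triangles are
`δ`-slim. -/
def IsHyperbolicSpace (δ : ℝ) (S : Type u) [MetricSpace S] : Prop :=
  (∀ x y : S, ∃ p : ArcPath S, p.IsGeodesic x y) ∧
  ∀ (x y z : S) (p q r : ArcPath S),
    p.IsGeodesic x y → q.IsGeodesic y z → r.IsGeodesic z x →
      p.image ⊆ nbhd (q.image ∪ r.image) δ ∧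
      q.image ⊆ nbhd (r.image ∪ p.image) δ ∧
      r.image ⊆ nbhd (p.image ∪ q.image) δ

/-! ### Translation length -/

/-- The translation length `lim d(x, fⁿ x) / n` of an isometry `f`, computed at some point `x`;
see `tendsto_translationLength` for the existence of the limit and its independence of `x`. -/
def translationLength {S : Type u} [MetricSpace S] [Nonempty S] (f : S → S) : ℝ :=
  limUnder atTop
    (fun n : ℕ => dist (Classical.arbitrary S) (f^[n] (Classical.arbitrary S)) / n)

theorem tendsto_translationLength {S : Type u} [MetricSpace S] [Nonempty S] (f : S → S)
    (hf : Isometry f) (x : S) :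
    Tendsto (fun n : ℕ => dist x (f^[n] x) / n) atTop (𝓝 (translationLength f)) := by
  have hiter : ∀ n : ℕ, Isometry (f^[n]) := by
    intro n
    induction n with
    | zero => exact isometry_id
    | succ n ih => rw [Function.iterate_succ]; exact ih.comp hf
  set y : S := Classical.arbitrary S with hy
  have hsub : Subadditive (fun n : ℕ => dist y (f^[n] y)) := by
    intro m n
    calc dist y (f^[m + n] y) ≤ dist y (f^[m] y) + dist (f^[m] y) (f^[m + n] y) :=
          dist_triangle _ _ _
      _ = _ := by rw [Function.iterate_add_apply, (hiter m).dist_eq]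
  have hbdd : BddBelow (Set.range fun n : ℕ => dist y (f^[n] y) / n) :=
    ⟨0, by rintro _ ⟨n, rfl⟩; positivity⟩
  have h1 := hsub.tendsto_lim hbdd
  have h2 : Tendsto (fun n : ℕ => dist y (f^[n] y) / n) atTop (𝓝 (translationLength f)) :=
    tendsto_nhds_limUnder ⟨_, h1⟩
  have h3 : Tendsto (fun n : ℕ => (2 * dist x y) / (n : ℝ)) atTop (𝓝 0) :=
    tendsto_const_div_atTop_nhds_zero_nat _
  refine (tendsto_iff_of_dist ?_).1 h2
  refine squeeze_zero (fun _ => dist_nonneg) (fun n => ?_) h3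
  rw [Real.dist_eq, ← sub_div, abs_div, Nat.abs_cast]
  gcongr
  have hd : dist (f^[n] x) (f^[n] y) = dist x y := (hiter n).dist_eq x y
  have a1 := dist_triangle4 y x (f^[n] x) (f^[n] y)
  have a2 := dist_triangle4 x y (f^[n] y) (f^[n] x)
  rw [dist_comm (f^[n] y), hd] at a2
  rw [dist_comm y x, hd] at a1
  rw [abs_le]
  constructor <;> linarith

/-- `x` almost minimises the displacement of `f`:
`d(x, f x) - inf_z d(z, f z) ≤ δ`. -/
def IsAlmostMinimal {S : Type u} [MetricSpace S] (δ : ℝ) (f : S → S) (x : S) : Prop :=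
  dist x (f x) - ⨅ z : S, dist z (f z) ≤ δ

/-- `T` and `K` are admissible constants for `δ`: in every `δ`-hyperbolic space, the orbit of an
almost minimally displaced point under an isometry `f` of translation length `τ ≥ T` satisfies
`i τ ≤ d(x, fⁱ x) ≤ i τ + K` for all `i ≥ 0`. -/
def AdmissibleConstants (δ T K : ℝ) : Prop :=
  0 < T ∧ 0 < K ∧
  ∀ (S : Type u) [MetricSpace S] [Nonempty S], IsHyperbolicSpace δ S →
    ∀ f : S ≃ᵢ S, T ≤ translationLength f →
      ∀ x : S, IsAlmostMinimal δ f x →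
        ∀ i : ℕ, i * translationLength f ≤ dist x (f^[i] x) ∧
          dist x (f^[i] x) ≤ i * translationLength f + K

/-! ### Group actions -/

/-- The translation length of `g ∈ Γ` acting on `S`. -/
def actionLength {Γ : Type v} [Group Γ] (S : Type u) [MetricSpace S] [Nonempty S] [MulAction Γ S]
    (g : Γ) : ℝ :=
  translationLength (fun x : S => g • x)

/-- `g` acts on `S` as a loxodromic isometry. -/
def IsLoxodromic {Γ : Type v} [Group Γ] (S : Type u) [MetricSpace S] [Nonempty S] [MulAction Γ S]
    (g : Γ) : Prop :=
  0 < actionLength S g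

/-- The action of `Γ` on `S` is acylindrical with parameters `R, N`. -/
def IsAcylindricalWith (Γ : Type v) [Group Γ] (S : Type u) [MetricSpace S] [MulAction Γ S]
    (R : ℝ → ℝ) (N : ℝ → ℕ) : Prop :=
  ∀ r : ℝ, 0 < r → 0 < R r ∧ 0 < N r ∧
    ∀ x x' : S, R r ≤ dist x x' →
      {g : Γ | dist x (g • x) ≤ r ∧ dist x' (g • x') ≤ r}.encard ≤ N r

/-- `a` is achiral: some power `a ^ m`, `m > 0`, is conjugate to its inverse. -/
def IsAchiral {Γ : Type v} [Group Γ] (a : Γ) : Prop :=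
  ∃ m : ℕ, 0 < m ∧ IsConj (a ^ m) (a ^ m)⁻¹

def IsChiral {Γ : Type v} [Group Γ] (a : Γ) : Prop :=
  ¬ IsAchiral a

/-! ### Epstein–Fujiwara counting functions -/

section Counting

variable (Γ : Type v) [Group Γ] {S : Type u} [MetricSpace S] [MulAction Γ S]

/-- The subpath of `α` on the parameter interval `[t, t + |w|]` is an (oriented) copy `a w` of `w`,
for some `a ∈ Γ`. -/
def IsCopyAt (w α : ArcPath S) (t : ℝ) : Prop :=
  0 ≤ t ∧ t + w.len ≤ α.len ∧
    ∃ a : Γ, ∀ s ∈ Set.Icc 0 w.len, α.toFun (t + s) = a • w.toFun s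

/-- `|α|_w`: the maximal number of non-overlapping oriented copies of `w` among the subpaths of
`α` (for `w` of positive length). Copies are recorded by their starting times; two subpaths of
length `|w|` are non-overlapping if these differ by at least `|w|`. -/
def copyCount (w α : ArcPath S) : ℕ :=
  sSup {n : ℕ | ∃ F : Finset ℝ, F.card = n ∧ (∀ t ∈ F, IsCopyAt Γ w α t) ∧
    ∀ t ∈ F, ∀ t' ∈ F, t ≠ t' → w.len ≤ |t - t'|}

/-- `c_{w,W}([x,y]) = d(x,y) - inf_α (|α| - W |α|_w)`, with `α` ranging over the paths from `x` to
`y` (of finite length; the others do not contribute to the infimum). -/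
def countFun (w : ArcPath S) (W : ℝ) (x y : S) : ℝ :=
  dist x y - sInf {v : ℝ | ∃ α : ArcPath S, α.source = x ∧ α.target = y ∧
    v = α.len - W * copyCount Γ w α}

/-- The Epstein–Fujiwara function `h_{w,W,x₀}`. -/
def efFun (w : ArcPath S) (W : ℝ) (x₀ : S) (a : Γ) : ℝ :=
  countFun Γ w W x₀ (a • x₀) - countFun Γ w.reverse W x₀ (a • x₀)

end Counting

/-- The homogenization `lim ψ(gⁿ) / n` (meaningful where the limit exists). -/
def homogenization {Γ : Type v} [Group Γ] (ψ : Γ → ℝ) (g : Γ) : ℝ :=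
  limUnder atTop (fun n : ℕ => ψ (g ^ n) / n)

end AcylGap

end

/-! Let `x` be almost minimal for `g ^ M`, let `w = [x, g ^ M • x]`, and let `τ` be the translation
length of `g`. The distances in the counting functions cancel, so `h (g ^ n)` is the least weighted
length from `x` to `g ^ n • x` for the reverse of `w`, minus that for `w`. The latter is subadditive
in `n`, and the path `w` itself costs at most `(M τ + K) - (K + 1) = M τ - 1`, so reaching `g ^ (M
n) • x` costs at most `n (M τ - 1)`. If reversed copies save nothing, the former is at least `d(x, g
^ (M n) • x) ≥ n M τ`. The difference is at least `n`, whence `1 / M` in the limit.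

Reversed copies could save only if some translate of the reverse of `w` advances along the orbit
with little loss (`dist_le_of_mem_weightedLengths`). Then a translate by `a` of the quasi-axis runs
backwards along it, and every `a gʲ a⁻¹ gʲ` with `j ≤ N r` moves two distant orbit points by at most
`r` (`IsFourPoint.dist_conj_pow_mul_pow_smul_le`). Acylindricity makes two of these elements equal,
so a power of `g` is conjugate to its inverse, against chirality.

Uniformity of `M` rests on two facts. A quasi-axis of `g ^ M` is one for `g`, with additive error
`2K + 24δ` whatever `M` and `g` are (`AdmissibleConstants.dist_pow_smul_le_of_pow`). Acylindricity
bounds `τ` away from zero (`IsAcylindricalWith.one_le_mul_actionLength`). Admissible constants exist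
by a local-to-global argument from the four-point condition. -/

noncomputable section

namespace AcylGap

universe u v

/-! ### The four-point condition -/

section FourPoint

variable {S : Type u} [MetricSpace S]

/-- Gromov's four-point condition: of the three sums of opposite distances of a quadruple, the
largest exceeds the second largest by at most `e`. -/
def IsFourPoint (e : ℝ) (S : Type u) [MetricSpace S] : Prop :=
  ∀ x y z w : S, dist x y + dist z w ≤ dist x z + dist y w + e ∨
    dist x y + dist z w ≤ dist x w + dist y z + e

namespace ArcPath.IsGeodesic

variable {p : ArcPath S} {x y : S}

theorem len_eq (h : p.IsGeodesic x y) : p.len = dist x y := by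
  obtain ⟨h1, h2, h3⟩ := h
  have := h3 0 ⟨le_rfl, p.len_nonneg⟩ p.len ⟨p.len_nonneg, le_rfl⟩
  rw [← h1, ← h2, source, target, this, zero_sub, abs_neg, abs_of_nonneg p.len_nonneg]

theorem dist_source (h : p.IsGeodesic x y) {t : ℝ} (ht : t ∈ Set.Icc 0 p.len) :
    dist x (p.toFun t) = t := by
  rw [← h.1, source, h.2.2 0 ⟨le_rfl, p.len_nonneg⟩ t ht, zero_sub, abs_neg, abs_of_nonneg ht.1]

theorem dist_target (h : p.IsGeodesic x y) {t : ℝ} (ht : t ∈ Set.Icc 0 p.len) :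
    dist (p.toFun t) y = p.len - t := by
  rw [← h.2.1, target, h.2.2 t ht p.len ⟨p.len_nonneg, le_rfl⟩, abs_sub_comm,
    abs_of_nonneg (sub_nonneg.2 ht.2)]

theorem dist_add_dist (h : p.IsGeodesic x y) {z : S} (hz : z ∈ p.image) :
    dist x z + dist z y = dist x y := by
  obtain ⟨t, ht, rfl⟩ := hz
  rw [h.dist_source ht, h.dist_target ht, ← h.len_eq]; ring

theorem continuousOn (h : p.IsGeodesic x y) : ContinuousOn p.toFun (Set.Icc 0 p.len) := by
  refine LipschitzOnWith.continuousOn (K := 1) (LipschitzOnWith.of_dist_le_mul fun s hs t ht => ?_)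
  rw [h.2.2 s hs t ht, Real.dist_eq, NNReal.coe_one, one_mul]

theorem isCompact_image (h : p.IsGeodesic x y) : IsCompact p.image :=
  isCompact_Icc.image_of_continuousOn h.continuousOn

theorem isPreconnected_image (h : p.IsGeodesic x y) : IsPreconnected p.image :=
  isPreconnected_Icc.image _ h.continuousOn

theorem left_mem (h : p.IsGeodesic x y) : x ∈ p.image :=
  ⟨0, ⟨le_rfl, p.len_nonneg⟩, h.1⟩

theorem right_mem (h : p.IsGeodesic x y) : y ∈ p.image :=
  ⟨p.len, ⟨p.len_nonneg, le_rfl⟩, h.2.1⟩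

end ArcPath.IsGeodesic

theorem exists_dist_le_of_mem_nbhd {A : Set S} (hA : IsCompact A) (hne : A.Nonempty) {r : ℝ}
    {x : S} (hx : x ∈ nbhd A r) : ∃ z ∈ A, dist x z ≤ r := by
  obtain ⟨z, hz, h⟩ := hA.exists_infDist_eq_dist hne x
  exact ⟨z, hz, h ▸ hx⟩

theorem isClosed_nbhd (A : Set S) (r : ℝ) : IsClosed (nbhd A r) :=
  isClosed_le (Metric.continuous_infDist_pt A) continuous_const

/-- A geodesic side of a slim triangle passes close to the opposite vertex, up to the Gromov
product. -/
theorem IsHyperbolicSpace.exists_mem_image_dist_le {δ : ℝ} (hδ : 0 ≤ δ)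
    (hS : IsHyperbolicSpace δ S) {x y : S} {p : ArcPath S} (hp : p.IsGeodesic x y) (w : S) :
    ∃ z ∈ p.image, 2 * dist w z ≤ dist w x + dist w y - dist x y + 4 * δ := by
  obtain ⟨q, hq⟩ := hS.1 y w
  obtain ⟨r, hr⟩ := hS.1 w x
  have hsub : p.image ⊆ nbhd q.image δ ∪ nbhd r.image δ := by
    intro z hz
    obtain ⟨z', hz', hd⟩ := exists_dist_le_of_mem_nbhd
      (hq.isCompact_image.union hr.isCompact_image) ⟨y, Or.inl hq.left_mem⟩
      ((hS.2 x y w p q r hp hq hr).1 hz)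
    rcases hz' with h | h
    · exact Or.inl ((Metric.infDist_le_dist_of_mem h).trans hd)
    · exact Or.inr ((Metric.infDist_le_dist_of_mem h).trans hd)
  have hy : y ∈ nbhd q.image δ := by
    rw [nbhd, Set.mem_ofPred_eq, Metric.infDist_zero_of_mem hq.left_mem]; exact hδ
  have hx : x ∈ nbhd r.image δ := by
    rw [nbhd, Set.mem_ofPred_eq, Metric.infDist_zero_of_mem hr.right_mem]; exact hδ
  -- The side is connected and covered by the closed neighbourhoods of the other two, so one of its
  -- points is `δ`-close to both.
  obtain ⟨z, hz, hzq, hzr⟩ := isPreconnected_closed_iff.1 hp.isPreconnected_image _ _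
    (isClosed_nbhd q.image δ) (isClosed_nbhd r.image δ) hsub ⟨y, hp.right_mem, hy⟩
    ⟨x, hp.left_mem, hx⟩
  obtain ⟨a, ha, hza⟩ := exists_dist_le_of_mem_nbhd hq.isCompact_image ⟨y, hq.left_mem⟩ hzq
  obtain ⟨b, hb, hzb⟩ := exists_dist_le_of_mem_nbhd hr.isCompact_image ⟨x, hr.right_mem⟩ hzr
  refine ⟨z, hz, ?_⟩
  have h1 := hq.dist_add_dist ha
  have h2 := hr.dist_add_dist hb
  have h3 := hp.dist_add_dist hz
  have h4 := dist_triangle y a z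
  have h5 := dist_triangle z a w
  have h6 := dist_triangle w b z
  have h7 := dist_triangle z b x
  simp only [dist_comm a z, dist_comm b z, dist_comm z y, dist_comm z w, dist_comm z x,
    dist_comm y w] at *
  linarith

/-- A point of `[x, z]` lies within the Gromov product plus `2δ` of `w`, and slimness moves it by
`δ` onto another side; the triangle inequality through the new point costs `4δ + 2δ`. -/
theorem IsHyperbolicSpace.isFourPoint {δ : ℝ} (hδ : 0 ≤ δ) (hS : IsHyperbolicSpace δ S) :
    IsFourPoint (6 * δ) S := by
  intro x z w y
  obtain ⟨p, hp⟩ := hS.1 x z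
  obtain ⟨q, hq⟩ := hS.1 z y
  obtain ⟨r, hr⟩ := hS.1 y x
  obtain ⟨a, ha, hwa⟩ := hS.exists_mem_image_dist_le hδ hp w
  obtain ⟨b, hb, hab⟩ := exists_dist_le_of_mem_nbhd
    (hq.isCompact_image.union hr.isCompact_image) ⟨z, Or.inl hq.left_mem⟩
    ((hS.2 x z y p q r hp hq hr).1 ha)
  have h0 := dist_triangle w a b
  rcases hb with hb | hb
  · left
    have h1 := hq.dist_add_dist hb
    have h2 := dist_triangle w b z
    have h3 := dist_triangle w b y
    rw [dist_comm b z] at h2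
    rw [dist_comm x w]
    linarith
  · right
    have h1 := hr.dist_add_dist hb
    have h2 := dist_triangle w b y
    have h3 := dist_triangle w b x
    rw [dist_comm b y] at h2
    rw [dist_comm x y, dist_comm z w]
    linarith

theorem IsHyperbolicSpace.exists_midpoint {δ : ℝ} (hS : IsHyperbolicSpace δ S) (x y : S) :
    ∃ m : S, dist x m = dist x y / 2 ∧ dist m y = dist x y / 2 := by
  obtain ⟨p, hp⟩ := hS.1 x y
  have hl := p.len_nonneg
  have hm : p.len / 2 ∈ Set.Icc 0 p.len := ⟨by linarith, by linarith⟩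
  refine ⟨p.toFun (p.len / 2), ?_, ?_⟩
  · rw [hp.dist_source hm, hp.len_eq]
  · rw [hp.dist_target hm, hp.len_eq]; ring

end FourPoint

/-! ### Translation length -/

section TranslationLength

variable {S : Type u} [MetricSpace S]

theorem isometry_iterate {f : S → S} (hf : Isometry f) (n : ℕ) : Isometry (f^[n]) := by
  induction n with
  | zero => exact isometry_id
  | succ n ih => rw [Function.iterate_succ]; exact ih.comp hf

theorem dist_iterate_add {f : S → S} (hf : Isometry f) (x : S) (i j : ℕ) :
    dist (f^[i] x) (f^[i + j] x) = dist x (f^[j] x) := by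
  rw [Function.iterate_add_apply, (isometry_iterate hf i).dist_eq]

theorem subadditive_dist_iterate {f : S → S} (hf : Isometry f) (x : S) :
    Subadditive (fun n : ℕ => dist x (f^[n] x)) := fun m n =>
  (dist_triangle _ (f^[m] x) _).trans_eq (by rw [dist_iterate_add hf])

variable [Nonempty S]

theorem mul_translationLength_le {f : S → S} (hf : Isometry f) (x : S) (n : ℕ) :
    n * translationLength f ≤ dist x (f^[n] x) := by
  rcases Nat.eq_zero_or_pos n with rfl | hn
  · simp
  have hbdd : BddBelow (Set.range fun n : ℕ => dist x (f^[n] x) / n) :=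
    ⟨0, by rintro _ ⟨n, rfl⟩; positivity⟩
  have hsub := subadditive_dist_iterate hf x
  have h := hsub.lim_le_div hbdd hn.ne'
  rw [tendsto_nhds_unique (hsub.tendsto_lim hbdd) (tendsto_translationLength f hf x),
    le_div_iff₀ (by exact_mod_cast hn)] at h
  linarith

theorem le_translationLength {f : S → S} (hf : Isometry f) {x : S} {c : ℝ}
    (h : ∀ n : ℕ, n * c ≤ dist x (f^[n] x)) : c ≤ translationLength f := by
  refine ge_of_tendsto (tendsto_translationLength f hf x) ?_
  filter_upwards [eventually_gt_atTop 0] with n hn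
  rw [le_div_iff₀ (by exact_mod_cast hn)]
  linarith [h n]

theorem translationLength_iterate {f : S → S} (hf : Isometry f) (k : ℕ) :
    translationLength (f^[k]) = k * translationLength f := by
  set x : S := Classical.arbitrary S
  rcases Nat.eq_zero_or_pos k with rfl | hk
  · have h := tendsto_translationLength (f^[0]) (isometry_iterate hf 0) x
    simp only [Function.iterate_zero, Function.iterate_id, id, dist_self, zero_div] at h
    simpa using tendsto_nhds_unique h tendsto_const_nhds
  have h1 := tendsto_translationLength (f^[k]) (isometry_iterate hf k) x
  have h2 := ((tendsto_translationLength f hf x).comp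
    (tendsto_id.nsmul_atTop hk)).const_mul (k : ℝ)
  refine tendsto_nhds_unique h1 (h2.congr fun n => ?_)
  have hk' : (k : ℝ) ≠ 0 := by exact_mod_cast hk.ne'
  simp only [Function.comp_apply, id, smul_eq_mul, Nat.cast_mul, ← Function.iterate_mul]
  rw [mul_div_assoc', mul_div_mul_left _ _ hk']

/-- Superadditivity up to `K` gives `n (d(x, fⁱ x) - K) ≤ d(x, fⁱⁿ x)`; dividing by `n` compares
with the translation length of `fⁱ`. -/
theorem dist_iterate_le_of_superadditive {f : S → S} (hf : Isometry f) {x : S} {K : ℝ}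
    (h : ∀ i j : ℕ, dist x (f^[i] x) + dist x (f^[j] x) ≤ dist x (f^[i + j] x) + K) (i : ℕ) :
    dist x (f^[i] x) ≤ i * translationLength f + K := by
  rw [← translationLength_iterate hf i, ← sub_le_iff_le_add]
  refine le_translationLength (isometry_iterate hf i) (x := x) fun n => ?_
  have hK : 0 ≤ K := by simpa using h 0 0
  rw [← Function.iterate_mul]
  suffices H : n * (dist x (f^[i] x) - K) + K ≤ dist x (f^[i * n] x) + K by linarith
  induction n with
  | zero => simp
  | succ n ih =>
    have := h (i * n) i
    rw [Nat.mul_succ]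
    push_cast
    linarith

end TranslationLength

/-! ### Existence of admissible constants -/

section Admissible

variable {S : Type u} [MetricSpace S]

/-- An orbit whose consecutive steps are long and nearly aligned is nearly additive. -/
theorem IsFourPoint.superadditive_dist_iterate {e : ℝ} (he : 0 ≤ e) (h4 : IsFourPoint e S)
    {f : S → S} (hf : Isometry f) {x : S} {c : ℝ}
    (hlong : c + 2 * e < dist x (f x)) (h2 : 2 * dist x (f x) - c ≤ dist x (f^[2] x)) (i j : ℕ) :
    dist x (f^[i] x) + dist x (f^[j] x) ≤ dist x (f^[i + j] x) + (c + 2 * e) := by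
  have hd := dist_iterate_add hf x
  set L := dist x (f x) with hL
  have h1 : dist x (f^[1] x) = L := rfl
  have hc : 0 ≤ c := by
    have := subadditive_dist_iterate hf x 1 1
    simp only [h1] at this
    have h3 : dist x (f^[1 + 1] x) = dist x (f^[2] x) := rfl
    linarith
  -- Each iterate gains almost `L`: the other four-point alternative would force `L ≤ c + e`.
  have step : ∀ i : ℕ, dist x (f^[i] x) + L - (c + e) ≤ dist x (f^[i + 1] x) := by
    intro i
    induction i with
    | zero => simp [← hL]; linarith
    | succ i ih =>
      have a1 := hd i 2
      have a2 := hd (i + 1) 1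
      have a3 := hd i 1
      rw [h1] at a2 a3
      rcases h4 x (f^[i + 1] x) (f^[i] x) (f^[i + 2] x) with h | h
      · have : dist (f^[i + 1] x) (f^[i + 2] x) = L := a2
        linarith
      · rw [dist_comm (f^[i + 1] x)] at h
        have : dist x (f^[i + 2] x) = dist x (f^[i + 1 + 1] x) := rfl
        linarith
  rcases j with _ | j
  · simp; linarith
  have b1 := step i
  have b2 := step j
  have b3 := hd i (j + 1)
  have b4 : dist (f^[i + 1] x) (f^[i + (j + 1)] x) = dist x (f^[j] x) := by
    rw [← hd (i + 1) j]; congr 2; ring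
  have b5 := hd i 1
  rw [h1] at b5
  rcases h4 x (f^[i + 1] x) (f^[i] x) (f^[i + (j + 1)] x) with h | h
  · linarith
  · rw [dist_comm (f^[i + 1] x)] at h
    linarith

/-- An almost minimally displaced point with long displacement moves nearly along a geodesic. -/
theorem IsHyperbolicSpace.two_mul_dist_sub_le {δ : ℝ} (hδ : 0 < δ) (hS : IsHyperbolicSpace δ S)
    {f : S → S} (hf : Isometry f) {x : S} (hx : IsAlmostMinimal δ f x)
    (hlong : 13 * δ < dist x (f x)) : 2 * dist x (f x) - 13 * δ ≤ dist x (f^[2] x) := by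
  -- The midpoint `m` of `x` and `f x` is also displaced by at least `d(x, f x) - δ`. This forces
  -- `x` and `f m` far apart, and then `x` and `f (f x)`, each time at a four-point cost of `6δ`.
  have h4 := hS.isFourPoint hδ.le
  obtain ⟨m, hm1, hm2⟩ := hS.exists_midpoint x (f x)
  have hmin : dist x (f x) - δ ≤ dist m (f m) := by
    have hb : BddBelow (Set.range fun z : S => dist z (f z)) :=
      ⟨0, by rintro _ ⟨z, rfl⟩; exact dist_nonneg⟩
    have := ciInf_le hb m
    unfold IsAlmostMinimal at hx
    linarith
  have e1 : dist (f x) (f m) = dist x (f x) / 2 := by rw [hf.dist_eq, hm1]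
  have e2 : dist (f m) (f (f x)) = dist x (f x) / 2 := by rw [hf.dist_eq, hm2]
  have e3 : dist (f x) (f (f x)) = dist x (f x) := hf.dist_eq _ _
  change _ ≤ dist x (f (f x))
  have q1 := h4 x (f m) (f x) (f (f x))
  have q2 := h4 m (f m) x (f x)
  rw [dist_comm (f m) (f x)] at q1 q2
  rw [dist_comm m x, dist_comm (f m) x] at q2
  rcases q1 with q1 | q1 <;> rcases q2 with q2 | q2 <;> linarith

end Admissible

theorem exists_admissibleConstants {δ : ℝ} (hδ : 0 < δ) :
    ∃ T K : ℝ, AdmissibleConstants.{u} δ T K := by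
  -- With `c = 13δ` and `e = 6δ`, the error `c + 2e` is `25δ`; `100δ` is comfortably above the
  -- displacement required.
  refine ⟨100 * δ, 25 * δ, by positivity, by positivity, ?_⟩
  intro S _ _ hS f hT x hx i
  have hf : Isometry f := f.isometry
  refine ⟨mul_translationLength_le hf x i, ?_⟩
  have hL : 100 * δ ≤ dist x (f x) := hT.trans (by simpa using mul_translationLength_le hf x 1)
  have h2 := hS.two_mul_dist_sub_le hδ hf hx (by linarith)
  refine dist_iterate_le_of_superadditive hf (fun i j => ?_) i
  have := (hS.isFourPoint hδ.le).superadditive_dist_iterate (by positivity) hf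
    (by linarith) h2 i j
  linarith

/-! ### Pigeonhole principle -/

theorem exists_lt_eq_of_encard_le {N : ℕ} {α : Type v} {X : Set α} (hX : X.encard ≤ N) {f : ℕ → α}
    (hf : ∀ j ≤ N, f j ∈ X) : ∃ i j, i < j ∧ j ≤ N ∧ f i = f j := by
  by_contra! hne
  have hinj : Set.InjOn f (Finset.range (N + 1) : Set ℕ) := by
    intro i hi j hj hij
    simp only [Finset.coe_range, Set.mem_Iio] at hi hj
    rcases lt_trichotomy i j with h | h | h
    · exact absurd hij (hne i j h (by omega))
    · exact h
    · exact absurd hij.symm (hne j i h (by omega))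
  have h1 : (f '' (Finset.range (N + 1) : Set ℕ)).encard ≤ N := by
    refine (Set.encard_le_encard ?_).trans hX
    rintro _ ⟨j, hj, rfl⟩
    simp only [Finset.coe_range, Set.mem_Iio] at hj
    exact hf j (by omega)
  rw [hinj.encard_image, Set.encard_coe_eq_coe_finsetCard, Finset.card_range] at h1
  have : N + 1 ≤ N := by exact_mod_cast h1
  omega

/-! ### Translation length of group elements -/

section Action

variable {Γ : Type v} [Group Γ] {S : Type u} [MetricSpace S] [MulAction Γ S]
  [IsIsometricSMul Γ S]

theorem dist_pow_smul_pow_smul (g : Γ) (x : S) (i j : ℕ) :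
    dist (g ^ i • x) (g ^ (i + j) • x) = dist x (g ^ j • x) := by
  rw [pow_add, mul_smul, dist_smul]

theorem dist_pow_smul_le_mul (g : Γ) (x : S) (n : ℕ) :
    dist x (g ^ n • x) ≤ n * dist x (g • x) := by
  induction n with
  | zero => simp
  | succ n ih =>
    have h1 := dist_triangle x (g ^ n • x) (g ^ (n + 1) • x)
    rw [dist_pow_smul_pow_smul, pow_one] at h1
    push_cast
    linarith

/-- As in a tree, a point nearly between `u` and `v` is nearly determined by its distance from `u`.
-/
theorem IsFourPoint.dist_le_of_aligned {e : ℝ} (h4 : IsFourPoint e S) {u v y z : S} {κ : ℝ}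
    (hy : dist u y + dist y v ≤ dist u v + κ) (hz : dist u z + dist z v ≤ dist u v + κ) :
    dist y z ≤ |dist u y - dist u z| + κ + e := by
  have h1 := le_abs_self (dist u y - dist u z)
  have h2 := neg_abs_le (dist u y - dist u z)
  rcases h4 y z u v with h | h
  · rw [dist_comm y u] at h; linarith
  · rw [dist_comm z u] at h; linarith

/-- The displacement of a point on a quasi-axis of `F` under powers of an element commuting with
`F` grows linearly. -/
theorem IsFourPoint.mul_le_dist_pow_smul_of_commute {e : ℝ} (he : 0 ≤ e) (h4 : IsFourPoint e S)
    {F h : Γ} (hc : Commute F h) {x : S} {τ K : ℝ} (hτ : 0 < τ) (hK : 0 ≤ K)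
    (hlo : ∀ n : ℕ, n * τ ≤ dist x (F ^ n • x)) (hup : ∀ n : ℕ, dist x (F ^ n • x) ≤ n * τ + K)
    (m : ℕ) : m * (dist x (h • x) - (2 * K + 4 * e)) ≤ dist x (h ^ m • x) := by
  set D := dist x (h • x) with hD
  have hD0 : 0 ≤ D := dist_nonneg
  -- The reference points `F⁻ⁿ x` and `Fⁿ x` are taken far beyond everything `h` reaches in `m`
  -- steps, so that `d(u, ·)` acts as a coordinate along the quasi-axis.
  obtain ⟨n, hn⟩ := exists_nat_gt ((2 * (m + 1) * D + K + e) / τ)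
  rw [div_lt_iff₀ hτ] at hn
  have hmD : 0 ≤ m * D := by positivity
  have hn' : 2 * (m * D) + 2 * D + K + e < n * τ := by linarith
  set A := n * τ with hA
  set u := (F ^ n)⁻¹ • x with hu
  set v := F ^ n • x with hv
  have hux : dist u x = dist x v := by
    rw [← dist_smul (F ^ n) u x, hu, smul_inv_smul]
  have huv : dist u v = dist x (F ^ (2 * n) • x) := by
    rw [← dist_smul (F ^ n) u v, hu, hv, smul_inv_smul, smul_smul, two_mul, pow_add]
  have hxv1 : A ≤ dist x v := hlo n
  have hxv2 : dist x v ≤ A + K := hup n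
  have huv1 : 2 * A ≤ dist u v := by
    have := hlo (2 * n); rw [← huv] at this; push_cast at this; linarith
  have hcu : h • u = (F ^ n)⁻¹ • h • x := by
    rw [hu, smul_smul, smul_smul, ((hc.pow_left n).inv_left).eq]
  have hcv : h • v = F ^ n • h • x := by
    rw [hv, smul_smul, smul_smul, (hc.pow_left n).eq]
  have huu : dist u (h • u) = D := by rw [hcu, hu, dist_smul]
  have hvv : dist v (h • v) = D := by rw [hcv, hv, dist_smul]
  have t1 : dist (h • u) (h • x) = dist u x := dist_smul ..
  have t2 : dist (h • x) (h • v) = dist x v := dist_smul ..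
  have t3 : dist (h • u) (h • v) = dist u v := dist_smul ..
  -- `h • x` is aligned with `u` and `v`
  have hal : dist u (h • x) + dist (h • x) v ≤ dist u v + (2 * K + 2 * e) := by
    have r1 := dist_triangle u (h • x) x
    rw [dist_comm (h • x) x] at r1
    have r1' := dist_triangle u (h • x) (h • v)
    have r3 := dist_triangle x (h • x) v
    have r4 := dist_triangle u (h • u) (h • v)
    have r5 := dist_triangle (h • u) u (h • v)
    rw [dist_comm (h • u) u] at r5
    rcases h4 u (h • x) (h • u) (h • v) with q1 | q1
    · linarith
    rw [dist_comm (h • x) (h • u)] at q1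
    rcases h4 v (h • x) (h • v) u with q2 | q2
    · rw [dist_comm (h • x) u, dist_comm (h • v) u, dist_comm v (h • x)] at q2
      have r6 := dist_triangle u x (h • x)
      linarith
    rw [dist_comm v (h • x), dist_comm (h • v) u, dist_comm v u] at q2
    linarith
  have hbase : D ≤ |dist u (h • x) - dist u x| + (2 * K + 2 * e) + e := by
    have := h4.dist_le_of_aligned (u := u) (v := v) (y := h • x) (z := x) hal
      (by linarith)
    rwa [dist_comm (h • x) x] at this
  set s := dist u (h • x) - dist u x with hs
  -- Every application of `h` shifts the coordinate by the same `s`, up to `e`: passing from `u` to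
  -- `h⁻ⁱ u`, at most `m D` away, hardly affects differences of distances to the remote points `x`
  -- and `h x`.
  have hstep : ∀ i : ℕ, i ≤ m →
      |dist u (h ^ (i + 1) • x) - dist u (h ^ i • x) - s| ≤ e := by
    intro i hi
    have hi' : (i : ℝ) * D ≤ m * D := by gcongr
    set u' := (h ^ i)⁻¹ • u with hu'
    have a1 : dist u (h ^ (i + 1) • x) = dist u' (h • x) := by
      rw [← dist_smul (h ^ i) u', hu', smul_inv_smul, smul_smul, pow_succ]
    have a2 : dist u (h ^ i • x) = dist u' x := by
      rw [← dist_smul (h ^ i) u', hu', smul_inv_smul]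
    have a3 : dist u u' ≤ i * D := by
      have : dist u u' = dist x (h ^ i • x) := by
        rw [← dist_smul (h ^ i) u u', hu', smul_inv_smul, hu, smul_smul,
          ((hc.pow_left n).inv_left.pow_right i).eq.symm, mul_smul, dist_smul, dist_comm]
      rw [this]
      exact dist_pow_smul_le_mul h x i
    have b1 := dist_triangle u u' x
    have b2 := dist_triangle u (h • x) x
    have b3 := dist_triangle u' (h • x) x
    rw [dist_comm (h • x) x] at b2 b3
    have q1 := h4 u (h • x) u' x
    have q2 := h4 u x u' (h • x)
    rw [dist_comm (h • x) x] at q1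
    rw [dist_comm (h • x) u'] at q1
    rw [dist_comm x u'] at q2
    rw [a1, a2, abs_le, hs]
    constructor
    · rcases q1 with q1 | q1 <;> linarith
    · rcases q2 with q2 | q2 <;> linarith
  have hsum : ∀ i : ℕ, i ≤ m → |dist u (h ^ i • x) - dist u x - i * s| ≤ i * e := by
    intro i
    induction i with
    | zero => simp
    | succ i ih =>
      intro hi
      have c1 := abs_le.1 (ih (by omega))
      have c2 := abs_le.1 (hstep i (by omega))
      push_cast
      rw [abs_le]
      constructor <;> linarith
  have c1 := abs_le.1 (hsum m le_rfl)
  have c2 := dist_triangle u x (h ^ m • x)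
  have c3 := dist_triangle u (h ^ m • x) x
  rw [dist_comm (h ^ m • x) x] at c3
  have hm0 : (0 : ℝ) ≤ m := by positivity
  rcases abs_cases s with ⟨hs', _⟩ | ⟨hs', _⟩
  · have := mul_le_mul_of_nonneg_left hbase hm0
    rw [hs'] at this
    linarith
  · have := mul_le_mul_of_nonneg_left hbase hm0
    rw [hs'] at this
    linarith

variable [Nonempty S]

theorem mul_actionLength_le (g : Γ) (x : S) (n : ℕ) :
    n * actionLength S g ≤ dist x (g ^ n • x) := by
  have := mul_translationLength_le (isometry_smul S g) x n
  rwa [smul_iterate_apply] at this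

theorem le_actionLength {g : Γ} {x : S} {c : ℝ} (h : ∀ n : ℕ, n * c ≤ dist x (g ^ n • x)) :
    c ≤ actionLength S g :=
  le_translationLength (isometry_smul S g) (x := x) fun n => by
    rw [smul_iterate_apply]; exact h n

theorem actionLength_pow (g : Γ) (k : ℕ) : actionLength S (g ^ k) = k * actionLength S g := by
  rw [actionLength, actionLength, ← translationLength_iterate (isometry_smul S g), smul_iterate]

theorem AdmissibleConstants.dist_pow_smul_le {δ T K : ℝ} (h : AdmissibleConstants.{u} δ T K)
    (hS : IsHyperbolicSpace δ S) {F : Γ} (hF : T ≤ actionLength S F) {x : S}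
    (hx : IsAlmostMinimal δ (fun z : S => F • z) x) (n : ℕ) :
    dist x (F ^ n • x) ≤ n * actionLength S F + K := by
  have := (h.2.2 S hS (IsometryEquiv.constSMul F) hF x hx n).2
  change dist x ((fun z : S => F • z)^[n] x) ≤ _ at this
  rwa [smul_iterate_apply] at this

theorem exists_isAlmostMinimal {δ : ℝ} (hδ : 0 < δ) (f : S → S) :
    ∃ x, IsAlmostMinimal δ f x := by
  obtain ⟨x, hx⟩ := exists_lt_of_ciInf_lt
    (show ⨅ z : S, dist z (f z) < (⨅ z : S, dist z (f z)) + δ by linarith)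
  exact ⟨x, by unfold IsAlmostMinimal; linarith⟩

/-- The linear growth of `d(x, hᵐ x)` in the limit; the error depends neither on `h` nor on `F`. -/
theorem IsFourPoint.dist_smul_le_of_commute {e : ℝ} (he : 0 ≤ e) (h4 : IsFourPoint e S)
    {F h : Γ} (hc : Commute F h) {x : S} {K : ℝ} (hτ : 0 < actionLength S F) (hK : 0 ≤ K)
    (hup : ∀ n : ℕ, dist x (F ^ n • x) ≤ n * actionLength S F + K) :
    dist x (h • x) ≤ actionLength S h + (2 * K + 4 * e) := by
  have := le_actionLength (g := h) (x := x) (h4.mul_le_dist_pow_smul_of_commute he hc hτ hK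
    (mul_actionLength_le F x) hup)
  linarith

/-- A quasi-axis of a power of `g` is a quasi-axis of `g`. -/
theorem AdmissibleConstants.dist_pow_smul_le_of_pow {δ T K : ℝ} (hδ : 0 < δ)
    (h : AdmissibleConstants.{u} δ T K) (hS : IsHyperbolicSpace δ S) {g : Γ} {M : ℕ}
    (hM : T ≤ actionLength S (g ^ M)) {x : S}
    (hx : IsAlmostMinimal δ (fun z : S => g ^ M • z) x) (j : ℕ) :
    dist x (g ^ j • x) ≤ j * actionLength S g + (2 * K + 4 * (6 * δ)) := by
  rw [← actionLength_pow]
  exact (hS.isFourPoint hδ.le).dist_smul_le_of_commute (by positivity)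
    ((Commute.refl g).pow_pow M j) (h.1.trans_le hM) h.2.1.le (h.dist_pow_smul_le hS hM hx)

/-! ### Acylindrical actions -/

/-- Translation lengths of loxodromic elements of an acylindrical action on a hyperbolic space are
bounded below. -/
theorem IsAcylindricalWith.one_le_mul_actionLength {δ T K : ℝ} (hδ : 0 < δ)
    (h : AdmissibleConstants.{u} δ T K) (hS : IsHyperbolicSpace δ S) {R : ℝ → ℝ} {N : ℝ → ℕ}
    (hac : IsAcylindricalWith Γ S R N) {g : Γ} (hg : IsLoxodromic S g) :
    1 ≤ N (2 * K + 4 * (6 * δ) + 1) * actionLength S g := by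
  by_contra! hlt
  set r := 2 * K + 4 * (6 * δ) + 1 with hr
  have hr0 : 0 < r := by have := h.2.1; positivity
  obtain ⟨-, -, hcard⟩ := hac r hr0
  have hg' : 0 < actionLength S g := hg
  -- A power long enough for admissibility. How large `k` is does not matter, since the error along
  -- the quasi-axis does not involve it.
  obtain ⟨k, hk⟩ := exists_nat_gt (T / actionLength S g)
  rw [div_lt_iff₀ hg', ← actionLength_pow] at hk
  obtain ⟨x, hx⟩ := exists_isAlmostMinimal hδ (fun z : S => g ^ k • z)
  have hd := h.dist_pow_smul_le_of_pow hδ hS hk.le hx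
  obtain ⟨i, hi⟩ := exists_nat_gt (R r / actionLength S g)
  rw [div_lt_iff₀ hg'] at hi
  -- Since `N r * τ < 1`, the first `N r` powers move `x`, and likewise `gⁱ x`, by at most `r`. Two
  -- of them then coincide, and a positive power of `g` would fix `x`.
  have hmem : ∀ j ≤ N r, dist x (g ^ j • x) ≤ r := by
    intro j hj
    have : (j : ℝ) * actionLength S g ≤ N r * actionLength S g := by gcongr
    linarith [hd j]
  obtain ⟨a, b, hab, -, heq⟩ := exists_lt_eq_of_encard_le
    (hcard x (g ^ i • x) (hi.le.trans (mul_actionLength_le g x i))) (f := fun j => g ^ j)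
    (fun j hj => ⟨hmem j hj, by
      rw [smul_smul, ← pow_add, add_comm, pow_add, mul_smul, dist_smul]; exact hmem j hj⟩)
  have h0 : dist x (g ^ (b - a) • x) = 0 := by
    rw [← dist_pow_smul_pow_smul g x a, Nat.add_sub_cancel' hab.le]
    rw [show g ^ a = g ^ b from heq, dist_self]
  have h1 := mul_actionLength_le g x (b - a)
  have h2 : (0 : ℝ) < (b - a : ℕ) := by exact_mod_cast Nat.sub_pos_of_lt hab
  have := mul_pos h2 hg'
  linarith

end Action

/-! ### Translates of a quasi-axis that run backwards -/

section Reverse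

variable {Γ : Type v} [Group Γ] {S : Type u} [MetricSpace S] [MulAction Γ S]
  [IsIsometricSMul Γ S]

/-- Four points `x, p, q, y` such that passing from `p` to `q` nearly realises the progress from
`x` to `y`: then `p` and `q` lie almost between `x` and `y`. -/
theorem IsFourPoint.aligned_of_progress {e W : ℝ} (h4 : IsFourPoint e S) {x y p q : S}
    (hprog : 2 * (dist p q - W) < dist x q - dist y q - (dist x p - dist y p))
    (hlong : 4 * W + e < 2 * dist p q) :
    dist x p + dist p q - 2 * W ≤ dist x q ∧ dist x q + dist q y ≤ dist x y + (2 * W + e) := by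
  have h1 := dist_triangle x p q
  have h2 := dist_triangle y q p
  rw [dist_comm q p] at h2
  refine ⟨by linarith, ?_⟩
  rw [dist_comm q y]
  rcases h4 x q p y with h | h
  · rw [dist_comm p y, dist_comm q y] at h; linarith
  · rw [dist_comm p y, dist_comm q p] at h; linarith

/-- If a translate by `a` of an orbit segment of `g` runs backwards along the orbit of `g`, then
`a gʲ a⁻¹ gʲ` nearly fixes the part of the orbit of `g` where they run together. -/
theorem IsFourPoint.dist_conj_pow_mul_pow_smul_le {e W C τ : ℝ} (h4 : IsFourPoint e S) {g a : Γ}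
    {x : S} (hlo : ∀ n : ℕ, n * τ ≤ dist x (g ^ n • x))
    (hup : ∀ n : ℕ, dist x (g ^ n • x) ≤ n * τ + C) (he : 0 ≤ e) (hW : 0 ≤ W) (hC : 0 ≤ C)
    {M P : ℕ}
    (hprog : 2 * (dist x (g ^ M • x) - W) < dist x (a • x) - dist (g ^ P • x) (a • x) -
      (dist x (a • g ^ M • x) - dist (g ^ P • x) (a • g ^ M • x)))
    (hlong : 4 * W + e < 2 * (M * τ)) :
    dist x (a • g ^ M • x) + M * τ ≤ P * τ + (C + 4 * W + e) ∧
    ∀ i j : ℕ, j ≤ M → i + j ≤ P → dist x (a • g ^ M • x) ≤ i * τ →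
      (i + j) * τ ≤ dist x (a • g ^ M • x) + M * τ →
      dist (g ^ i • x) ((a * g ^ j * a⁻¹ * g ^ j) • g ^ i • x) ≤
        4 * (6 * W + 4 * C + 2 * e) + e := by
  set y := g ^ P • x with hy
  set p := a • g ^ M • x with hp
  set q := a • x with hq
  set β := dist x p with hβ
  have hpq : dist p q = dist x (g ^ M • x) := by rw [hp, hq, dist_smul, dist_comm]
  have hM1 := hlo M
  obtain ⟨hxq, hqy⟩ := h4.aligned_of_progress (x := x) (y := y) (p := p) (q := q) (W := W)
    (by rw [hpq]; exact hprog) (by rw [hpq]; linarith)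
  have hy2 := hup P
  rw [← hy] at hy2
  refine ⟨by linarith [dist_nonneg (x := q) (y := y)], ?_⟩
  -- points of the reversed orbit
  have hz : ∀ k : ℕ, k ≤ M →
      dist x (a • g ^ k • x) + dist (a • g ^ k • x) y ≤ dist x y + (4 * W + 2 * C + e) ∧
      dist x (a • g ^ k • x) ≤ β + (M - k) * τ + C ∧
      β + (M - k) * τ - 2 * W - C ≤ dist x (a • g ^ k • x) := by
    intro k hk
    have e1 : dist p (a • g ^ k • x) ≤ (M - k) * τ + C := by
      have h1 := dist_pow_smul_pow_smul g x k (M - k)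
      have h2 := hup (M - k)
      rw [Nat.add_sub_cancel' hk] at h1
      rw [Nat.cast_sub hk] at h2
      rw [hp, dist_smul, dist_comm, h1]
      exact h2
    have e2 : dist (a • g ^ k • x) q ≤ k * τ + C := by
      rw [hq, dist_smul, dist_comm]; exact hup k
    have t1 := dist_triangle x p (a • g ^ k • x)
    have t2 := dist_triangle (a • g ^ k • x) q y
    have t3 := dist_triangle x (a • g ^ k • x) q
    exact ⟨by linarith, by linarith, by linarith⟩
  -- points of the orbit
  have hx : ∀ i : ℕ, i ≤ P →
      dist x (g ^ i • x) + dist (g ^ i • x) y ≤ dist x y + 2 * C := by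
    intro i hi
    have h1 := dist_pow_smul_pow_smul g x i (P - i)
    have h2 := hup (P - i)
    rw [Nat.add_sub_cancel' hi] at h1
    rw [Nat.cast_sub hi] at h2
    rw [hy, h1]
    have := hlo P
    linarith [hup i]
  have hdist : ∀ i k : ℕ, i ≤ P → k ≤ M →
      dist (g ^ i • x) (a • g ^ k • x) ≤
        |i * τ - (β + (M - k) * τ)| + (6 * W + 4 * C + 2 * e) := by
    intro i k hi hk
    obtain ⟨z1, z2, z3⟩ := hz k hk
    have h1 := h4.dist_le_of_aligned (u := x) (v := y) (y := g ^ i • x) (z := a • g ^ k • x)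
      (by linarith [hx i hi]) z1
    have h2 : |dist x (g ^ i • x) - dist x (a • g ^ k • x)| ≤
        |i * τ - (β + (M - k) * τ)| + (2 * W + 2 * C) := by
      have l1 := hlo i
      have l2 := hup i
      have a1 := le_abs_self (i * τ - (β + (M - k) * τ))
      have a2 := neg_abs_le (i * τ - (β + (M - k) * τ))
      rw [abs_le]
      constructor <;> linarith
    linarith
  intro i j hj hij hi1 hi2
  set Q := 6 * W + 4 * C + 2 * e with hQ
  have hcast : ((i + j : ℕ) : ℝ) = i + j := by push_cast; ring
  set z := g ^ i • x with hzdef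
  set z' := (a * g ^ j * a⁻¹ * g ^ j) • z with hz'
  -- On the common stretch `gʲ` advances by `j τ` and its conjugate by `a` goes back by as much, so
  -- `z'` and `z` have nearly the same position between `p` and `a gʲ x`.
  have hz'k : ∀ k : ℕ, dist z' (a • g ^ (k + j) • x) = dist (g ^ (i + j) • x) (a • g ^ k • x) := by
    intro k
    have e1 : z' = (a * g ^ j * a⁻¹) • g ^ (i + j) • x := by
      rw [hz', hzdef, mul_smul, smul_smul (g ^ j) (g ^ i), ← pow_add, add_comm j i]
    have e2 : a • g ^ (k + j) • x = (a * g ^ j * a⁻¹) • a • g ^ k • x := by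
      simp only [smul_smul, mul_assoc, inv_mul_cancel_left, ← pow_add]
      rw [add_comm]
    rw [e1, e2, dist_smul]
  have d1 : dist z p ≤ i * τ - β + Q := by
    have := hdist i M (by omega) le_rfl
    rw [sub_self, zero_mul, add_zero, abs_of_nonneg (by linarith)] at this
    exact this
  have d2 : dist z (a • g ^ j • x) ≤ β + (M - j) * τ - i * τ + Q := by
    have := hdist i j (by omega) hj
    rw [abs_of_nonpos (by linarith)] at this
    linarith
  have d3 : dist z' p ≤ i * τ - β + Q := by
    have h1 := hz'k (M - j)
    have h2 := hdist (i + j) (M - j) hij (by omega)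
    rw [Nat.sub_add_cancel hj] at h1
    rw [← h1, hcast, Nat.cast_sub hj] at h2
    have h3 : ((i : ℝ) + j) * τ - (β + (M - (M - j)) * τ) = i * τ - β := by ring
    rw [h3, abs_of_nonneg (by linarith)] at h2
    exact h2
  have d4 : dist z' (a • g ^ j • x) ≤ β + (M - j) * τ - i * τ + Q := by
    have h1 := hz'k 0
    have h2 := hdist (i + j) 0 hij (by omega)
    rw [zero_add] at h1
    rw [← h1, hcast, Nat.cast_zero, abs_of_nonpos (by linarith)] at h2
    linarith
  have d5 : (M - j) * τ ≤ dist p (a • g ^ j • x) := by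
    have h1 := dist_pow_smul_pow_smul g x j (M - j)
    have h2 := hlo (M - j)
    rw [Nat.add_sub_cancel' hj] at h1
    rw [Nat.cast_sub hj] at h2
    rw [hp, dist_smul, dist_comm, h1]
    exact h2
  have t1 := dist_triangle p z (a • g ^ j • x)
  have t2 := dist_triangle p z' (a • g ^ j • x)
  rw [dist_comm] at d1 d3
  have hfin := h4.dist_le_of_aligned (u := p) (v := a • g ^ j • x) (y := z) (z := z')
    (κ := 2 * Q) (by linarith) (by linarith)
  have habs : |dist p z - dist p z'| ≤ 2 * Q := by
    rw [abs_le]; constructor <;> linarith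
  linarith

/-- In an acylindrical action, long translates of the quasi-axis of a chiral element do not run
backwards along it. -/
theorem IsAcylindricalWith.progress_le_of_isChiral {e W C τ : ℝ} (h4 : IsFourPoint e S)
    {R : ℝ → ℝ} {N : ℝ → ℕ} (hac : IsAcylindricalWith Γ S R N) {g : Γ} (hg : IsChiral g)
    {x : S} (hτ : 0 < τ) (hlo : ∀ n : ℕ, n * τ ≤ dist x (g ^ n • x))
    (hup : ∀ n : ℕ, dist x (g ^ n • x) ≤ n * τ + C) (he : 0 ≤ e) (hW : 0 < W) (hC : 0 ≤ C)
    {r : ℝ} (hr : r = 4 * (6 * W + 4 * C + 2 * e) + e) {M ρ σ : ℕ}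
    (hρ : R r ≤ ρ * τ) (hσ : C + 4 * W + e ≤ σ * τ) (hM : 1 + ρ + N r + σ ≤ M) (P : ℕ) (a : Γ) :
    dist x (a • x) - dist (g ^ P • x) (a • x) -
      (dist x (a • g ^ M • x) - dist (g ^ P • x) (a • g ^ M • x)) ≤
      2 * (dist x (g ^ M • x) - W) := by
  by_contra! hprog
  -- The summands of the bound on `M` pay for rounding `β / τ` up, for two points at distance `R r`,
  -- for the shifts by `j ≤ N r`, and for the loss at the far end.
  have hMr : (1 + ρ + N r + σ : ℝ) * τ ≤ M * τ := by
    have : (1 + ρ + N r + σ : ℝ) ≤ M := by exact_mod_cast hM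
    gcongr
  have hnn : (0 : ℝ) ≤ ρ * τ ∧ (0 : ℝ) ≤ N r * τ := ⟨by positivity, by positivity⟩
  obtain ⟨hend, hdisp⟩ := h4.dist_conj_pow_mul_pow_smul_le hlo hup he hW.le hC hprog (by linarith)
  set β := dist x (a • g ^ M • x) with hβ
  have hβ0 : 0 ≤ β := dist_nonneg
  obtain ⟨-, -, hcard⟩ := hac r (by rw [hr]; positivity)
  set i := ⌈β / τ⌉₊ with hi
  have hi1 : β ≤ i * τ := by rw [← div_le_iff₀ hτ]; exact Nat.le_ceil _
  have hi2 : i * τ ≤ β + τ := by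
    have := (Nat.ceil_lt_add_one (show 0 ≤ β / τ by positivity)).le
    have h2 := mul_le_mul_of_nonneg_right this hτ.le
    rwa [add_mul, div_mul_cancel₀ _ hτ.ne', one_mul] at h2
  have hP : i + ρ + N r ≤ P := by
    have : (i + ρ + N r : ℝ) * τ ≤ P * τ := by linarith
    exact_mod_cast le_of_mul_le_mul_right this hτ
  have hmem : ∀ k ≤ ρ, ∀ j ≤ N r,
      dist (g ^ (i + k) • x) ((a * g ^ j * a⁻¹ * g ^ j) • g ^ (i + k) • x) ≤ r := by
    intro k hk j hj
    have hk' : (k : ℝ) * τ ≤ ρ * τ := by gcongr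
    have hk0 : (0 : ℝ) ≤ k * τ := by positivity
    have hj' : (j : ℝ) * τ ≤ N r * τ := by gcongr
    have hσ0 : (0 : ℝ) ≤ σ * τ := by positivity
    rw [hr]
    refine hdisp (i + k) j (by omega) (by omega) ?_ ?_ <;> push_cast <;> linarith
  have hfar : R r ≤ dist (g ^ (i + 0) • x) (g ^ (i + ρ) • x) := by
    rw [add_zero, dist_pow_smul_pow_smul]; exact hρ.trans (hlo ρ)
  obtain ⟨b, c, hbc, -, heq⟩ := exists_lt_eq_of_encard_le (hcard _ _ hfar)
    (f := fun j => a * g ^ j * a⁻¹ * g ^ j)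
    (fun j hj => ⟨hmem 0 (Nat.zero_le _) j hj, hmem ρ le_rfl j hj⟩)
  refine hg ⟨c - b, Nat.sub_pos_of_lt hbc, isConj_iff.2 ⟨a, ?_⟩⟩
  obtain ⟨m, rfl⟩ := Nat.exists_eq_add_of_lt hbc
  -- Cancelling the outer factors from the equality of the elements with exponents `b` and `c`
  -- leaves `a g^(c-b) a⁻¹ g^(c-b) = 1`.
  rw [show b + m + 1 - b = m + 1 by omega, eq_inv_iff_mul_eq_one]
  have h1 : a * g ^ b * a⁻¹ * g ^ b =
      a * g ^ b * a⁻¹ * (a * g ^ (m + 1) * a⁻¹ * g ^ (m + 1)) * g ^ b := by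
    refine (show a * g ^ b * a⁻¹ * g ^ b = a * g ^ (b + m + 1) * a⁻¹ * g ^ (b + m + 1) from
      heq).trans ?_
    nth_rewrite 2 [show b + m + 1 = (m + 1) + b by ring]
    rw [add_assoc, pow_add g b, pow_add g (m + 1) b]
    group
  have h2 := mul_right_cancel h1
  exact (mul_eq_left.1 h2.symm)

end Reverse

/-! ### Operations on paths -/

section Paths

variable {S : Type u} [MetricSpace S]

theorem hasUnitSpeedOn_congr {f f' : ℝ → S} {s : Set ℝ} (h : HasUnitSpeedOn f s)
    (hff' : Set.EqOn f' f s) : HasUnitSpeedOn f' s := fun x hx y hy => by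
  rw [eVariationOn.congr (hff'.mono Set.inter_subset_left)]
  exact h hx hy

theorem hasUnitSpeedOn_comp_sub {f : ℝ → S} {b : ℝ} (h : HasUnitSpeedOn f (Set.Icc 0 b))
    (c : ℝ) : HasUnitSpeedOn (fun t => f (t - c)) (Set.Icc c (c + b)) := by
  intro x hx y hy
  have hmono : MonotoneOn (fun t : ℝ => t - c) (Set.Icc c (c + b) ∩ Set.Icc x y) :=
    fun _ _ _ _ hab => sub_le_sub_right hab _
  have himg : (fun t : ℝ => t - c) '' (Set.Icc c (c + b) ∩ Set.Icc x y)
      = Set.Icc 0 b ∩ Set.Icc (x - c) (y - c) := by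
    rw [Set.Icc_inter_Icc, Set.Icc_inter_Icc, Set.image_sub_const_Icc]
    congr 1
    · rw [max_eq_right hx.1, max_eq_right (by linarith [hx.1])]
    · rw [min_eq_right hy.2, min_eq_right (by linarith [hy.2])]
  have h1 := eVariationOn.comp_eq_of_monotoneOn f (fun t : ℝ => t - c) hmono
  rw [himg] at h1
  have h2 := h (x := x - c) ⟨by linarith [hx.1], by linarith [hx.2]⟩
    (y := y - c) ⟨by linarith [hy.1], by linarith [hy.2]⟩
  rw [sub_sub_sub_cancel_right] at h2
  exact h1.trans h2

namespace ArcPath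

theorem dist_le (p : ArcPath S) {s t : ℝ} (hs : 0 ≤ s) (hst : s ≤ t) (ht : t ≤ p.len) :
    dist (p.toFun s) (p.toFun t) ≤ t - s := by
  have hs' : s ∈ Set.Icc 0 p.len := ⟨hs, hst.trans ht⟩
  have ht' : t ∈ Set.Icc 0 p.len := ⟨hs.trans hst, ht⟩
  have h1 := eVariationOn.edist_le p.toFun (s := Set.Icc 0 p.len ∩ Set.Icc s t)
    ⟨hs', le_rfl, hst⟩ ⟨ht', hst, le_rfl⟩
  rw [p.unitSpeed hs' ht', NNReal.coe_one, one_mul, edist_dist,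
    ENNReal.ofReal_le_ofReal_iff (sub_nonneg.2 hst)] at h1
  exact h1

/-- The path `p` followed by the path `q`. -/
def concat (p q : ArcPath S) (h : p.target = q.source) : ArcPath S where
  len := p.len + q.len
  len_nonneg := add_nonneg p.len_nonneg q.len_nonneg
  toFun t := if t ≤ p.len then p.toFun t else q.toFun (t - p.len)
  unitSpeed := by
    refine HasUnitSpeedOn.Icc_Icc (y := p.len) ?_ ?_
    · exact hasUnitSpeedOn_congr p.unitSpeed fun t ht => if_pos ht.2
    · refine hasUnitSpeedOn_congr (hasUnitSpeedOn_comp_sub q.unitSpeed p.len) fun t ht => ?_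
      rcases ht.1.eq_or_lt with rfl | hlt
      · simpa [target, source] using h
      · exact if_neg hlt.not_ge

variable {p q : ArcPath S} (h : p.target = q.source)

theorem concat_toFun_left {t : ℝ} (ht : t ≤ p.len) : (p.concat q h).toFun t = p.toFun t :=
  if_pos ht

theorem concat_toFun_right {t : ℝ} (ht : 0 ≤ t) :
    (p.concat q h).toFun (p.len + t) = q.toFun t := by
  rcases ht.eq_or_lt with rfl | hlt
  · rw [add_zero, concat_toFun_left h le_rfl]; exact h
  · refine (if_neg (by linarith)).trans ?_
    rw [add_sub_cancel_left]

theorem concat_source : (p.concat q h).source = p.source := concat_toFun_left h p.len_nonneg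

theorem concat_target : (p.concat q h).target = q.target := concat_toFun_right h q.len_nonneg

/-- The translate `a p` of a path. -/
def translate {Γ : Type v} [Group Γ] [MulAction Γ S] [IsIsometricSMul Γ S] (a : Γ)
    (p : ArcPath S) : ArcPath S where
  len := p.len
  len_nonneg := p.len_nonneg
  toFun t := a • p.toFun t
  unitSpeed := fun x hx y hy => by
    have h : ∀ s, eVariationOn (fun t => a • p.toFun t) s = eVariationOn p.toFun s := fun s => by
      simp only [eVariationOn, edist_smul_left]
    rw [h]
    exact p.unitSpeed hx hy

end ArcPath

end Paths

/-! ### Counting copies -/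

/-- A monotone function that gains at least `W` over each of finitely many non-overlapping
intervals of length `ℓ` gains at least `W` times their number. -/
theorem card_mul_le_sub_of_monotoneOn {ψ : ℝ → ℝ} {ℓ W b : ℝ} (hb : 0 ≤ b)
    (hψ : MonotoneOn ψ (Set.Icc 0 b)) (hℓ : 0 ≤ ℓ) (F : Finset ℝ)
    (hF : ∀ t ∈ F, 0 ≤ t ∧ t + ℓ ≤ b) (hsep : ∀ t ∈ F, ∀ t' ∈ F, t ≠ t' → ℓ ≤ |t - t'|)
    (hjump : ∀ t ∈ F, W ≤ ψ (t + ℓ) - ψ t) : F.card * W ≤ ψ b - ψ 0 := by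
  suffices H : ∀ c, 0 ≤ c → c ≤ b → (∀ t ∈ F, t + ℓ ≤ c) → F.card * W ≤ ψ c - ψ 0 from
    H b hb le_rfl fun t ht => (hF t ht).2
  clear hb
  induction F using Finset.induction_on_max with
  | empty =>
    intro c hc hcb _
    simpa using hψ ⟨le_rfl, hc.trans hcb⟩ ⟨hc, hcb⟩ hc
  | insert a F hlt ih =>
    intro c hc hcb hFc
    have ha := hF a (Finset.mem_insert_self a F)
    have hac := hFc a (Finset.mem_insert_self a F)
    have h1 := ih (fun t ht => hF t (Finset.mem_insert_of_mem ht))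
      (fun t ht t' ht' => hsep t (Finset.mem_insert_of_mem ht) t' (Finset.mem_insert_of_mem ht'))
      (fun t ht => hjump t (Finset.mem_insert_of_mem ht)) a ha.1 (by linarith) (fun t ht => by
        have h2 := hsep a (Finset.mem_insert_self a F) t (Finset.mem_insert_of_mem ht)
          (hlt t ht).ne'
        rw [abs_of_pos (sub_pos.2 (hlt t ht))] at h2
        linarith)
    have h2 := hjump a (Finset.mem_insert_self a F)
    have h3 := hψ ⟨by linarith [ha.1], by linarith⟩ ⟨hc, hcb⟩ hac
    rw [Finset.card_insert_of_notMem fun h => (hlt a h).ne rfl]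
    push_cast
    linarith

section Counting

variable (Γ : Type v) [Group Γ] {S : Type u} [MetricSpace S] [MulAction Γ S]

/-- `F` is a set of starting times of non-overlapping copies of `w` in `α`. -/
def IsCopyPacking (w α : ArcPath S) (F : Finset ℝ) : Prop :=
  (∀ t ∈ F, IsCopyAt Γ w α t) ∧ ∀ t ∈ F, ∀ t' ∈ F, t ≠ t' → w.len ≤ |t - t'|

variable {Γ} {w α : ArcPath S}

theorem IsCopyPacking.card_mul_len_le {F : Finset ℝ} (h : IsCopyPacking Γ w α F) :
    F.card * w.len ≤ α.len := by
  have := card_mul_le_sub_of_monotoneOn (ψ := id) (W := w.len) α.len_nonneg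
    (monotone_id.monotoneOn _) w.len_nonneg F (fun t ht => ⟨(h.1 t ht).1, (h.1 t ht).2.1⟩) h.2
    (fun t _ => by simp)
  simpa using this

/-- Without this bound the natural-number supremum in `copyCount` could be the default value `0`. -/
theorem bddAbove_card_isCopyPacking (hw : 0 < w.len) (α : ArcPath S) :
    BddAbove {n : ℕ | ∃ F : Finset ℝ, F.card = n ∧ IsCopyPacking Γ w α F} := by
  refine ⟨⌊α.len / w.len⌋₊, ?_⟩
  rintro _ ⟨F, rfl, hF⟩
  exact Nat.le_floor ((le_div_iff₀ hw).2 hF.card_mul_len_le)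

theorem IsCopyPacking.card_le_copyCount (hw : 0 < w.len) {F : Finset ℝ}
    (h : IsCopyPacking Γ w α F) : F.card ≤ copyCount Γ w α :=
  le_csSup (bddAbove_card_isCopyPacking hw α) ⟨F, rfl, h⟩

variable (Γ) in
theorem exists_isCopyPacking_card_eq (hw : 0 < w.len) (α : ArcPath S) :
    ∃ F : Finset ℝ, F.card = copyCount Γ w α ∧ IsCopyPacking Γ w α F :=
  Nat.sSup_mem (s := {n : ℕ | ∃ F : Finset ℝ, F.card = n ∧ IsCopyPacking Γ w α F})
    ⟨0, ∅, rfl, by simp [IsCopyPacking]⟩ (bddAbove_card_isCopyPacking hw α)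

theorem one_le_copyCount_self (hw : 0 < w.len) : 1 ≤ copyCount Γ w w := by
  have h : IsCopyPacking Γ w w {0} :=
    ⟨fun t ht => by
      rw [Finset.mem_singleton.1 ht]
      exact ⟨le_rfl, by simp, 1, fun s _ => by simp⟩,
    fun t ht t' ht' hne => by
      rw [Finset.mem_singleton.1 ht, Finset.mem_singleton.1 ht'] at hne
      exact absurd rfl hne⟩
  simpa using h.card_le_copyCount hw

theorem copyCount_translate [IsIsometricSMul Γ S] (hw : 0 < w.len) (a : Γ) (α : ArcPath S) :
    copyCount Γ w α ≤ copyCount Γ w (α.translate a) := by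
  obtain ⟨F, hcard, hF⟩ := exists_isCopyPacking_card_eq Γ hw α
  rw [← hcard]
  refine IsCopyPacking.card_le_copyCount hw ⟨fun t ht => ?_, hF.2⟩
  obtain ⟨h1, h2, b, hb⟩ := hF.1 t ht
  refine ⟨h1, h2, a * b, fun s hs => ?_⟩
  rw [mul_smul, ← hb s hs]
  rfl

theorem copyCount_add_le_concat (hw : 0 < w.len) {α β : ArcPath S} (h : α.target = β.source) :
    copyCount Γ w α + copyCount Γ w β ≤ copyCount Γ w (α.concat β h) := by
  classical
  obtain ⟨F, hcF, hF⟩ := exists_isCopyPacking_card_eq Γ hw α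
  obtain ⟨G, hcG, hG⟩ := exists_isCopyPacking_card_eq Γ hw β
  have hlen : (α.concat β h).len = α.len + β.len := rfl
  have hcross : ∀ t ∈ F, ∀ t' ∈ G.image (α.len + ·), w.len ≤ t' - t := by
    intro t ht t' ht'
    obtain ⟨s, hs, rfl⟩ := Finset.mem_image.1 ht'
    linarith [(hF.1 t ht).2.1, (hG.1 s hs).1]
  have hdisj : Disjoint F (G.image (α.len + ·)) := by
    rw [Finset.disjoint_left]
    intro t ht ht'
    linarith [hcross t ht t ht']
  have hcard : (F ∪ G.image (α.len + ·)).card = copyCount Γ w α + copyCount Γ w β := by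
    rw [Finset.card_union_of_disjoint hdisj,
      Finset.card_image_of_injective _ (add_right_injective α.len), hcF, hcG]
  rw [← hcard]
  refine IsCopyPacking.card_le_copyCount hw ⟨fun t ht => ?_, fun t ht t' ht' hne => ?_⟩
  · rcases Finset.mem_union.1 ht with ht | ht
    · obtain ⟨h1, h2, a, ha⟩ := hF.1 t ht
      refine ⟨h1, by linarith [β.len_nonneg], a, fun s hs => ?_⟩
      rw [ArcPath.concat_toFun_left h (by linarith [hs.2])]
      exact ha s hs
    · obtain ⟨r, hr, rfl⟩ := Finset.mem_image.1 ht
      obtain ⟨h1, h2, a, ha⟩ := hG.1 r hr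
      refine ⟨by linarith [α.len_nonneg], by linarith, a, fun s hs => ?_⟩
      rw [add_assoc, ArcPath.concat_toFun_right h (by linarith [hs.1])]
      exact ha s hs
  · rcases Finset.mem_union.1 ht with h1 | h1 <;> rcases Finset.mem_union.1 ht' with h2 | h2
    · exact hF.2 t h1 t' h2 hne
    · rw [abs_sub_comm]
      exact (hcross t h1 t' h2).trans (le_abs_self _)
    · exact (hcross t' h2 t h1).trans (le_abs_self _)
    · obtain ⟨r, hr, rfl⟩ := Finset.mem_image.1 h1
      obtain ⟨r', hr', rfl⟩ := Finset.mem_image.1 h2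
      rw [add_sub_add_left_eq_sub]
      exact hG.2 r hr r' hr' fun h => hne (by rw [h])

/-! ### The weighted length -/

variable (Γ) in
/-- The set of the values `|α| - W |α|_w` for paths `α` from `x` to `y`. -/
def weightedLengths (w : ArcPath S) (W : ℝ) (x y : S) : Set ℝ :=
  {v : ℝ | ∃ α : ArcPath S, α.source = x ∧ α.target = y ∧ v = α.len - W * copyCount Γ w α}

/-- Non-overlapping copies have total length at most `|α|`, and each is discounted by at most its
own length. -/
theorem nonneg_of_mem_weightedLengths {W : ℝ} (hw : 0 < w.len) (hW : W ≤ w.len) {x y : S} {v : ℝ}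
    (hv : v ∈ weightedLengths Γ w W x y) : 0 ≤ v := by
  obtain ⟨α, -, -, rfl⟩ := hv
  obtain ⟨F, hcF, hF⟩ := exists_isCopyPacking_card_eq Γ hw α
  have h1 := hF.card_mul_len_le
  rw [hcF] at h1
  have h2 : W * copyCount Γ w α ≤ w.len * copyCount Γ w α := by gcongr
  linarith

theorem bddBelow_weightedLengths {W : ℝ} (hw : 0 < w.len) (hW : W ≤ w.len) (x y : S) :
    BddBelow (weightedLengths Γ w W x y) :=
  ⟨0, fun _ => nonneg_of_mem_weightedLengths hw hW⟩

theorem IsHyperbolicSpace.weightedLengths_nonempty {δ : ℝ} (hS : IsHyperbolicSpace δ S)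
    (w : ArcPath S) (W : ℝ) (x y : S) : (weightedLengths Γ w W x y).Nonempty := by
  obtain ⟨p, hp⟩ := hS.1 x y
  exact ⟨_, p, hp.1, hp.2.1, rfl⟩

theorem efFun_eq (w : ArcPath S) (W : ℝ) (x : S) (a : Γ) :
    efFun Γ w W x a = sInf (weightedLengths Γ w.reverse W x (a • x)) -
      sInf (weightedLengths Γ w W x (a • x)) := by
  change dist x (a • x) - sInf (weightedLengths Γ w W x (a • x)) -
    (dist x (a • x) - sInf (weightedLengths Γ w.reverse W x (a • x))) = _
  ring

/-- If no copy of `w` makes more progress than `|w| - W` in the direction from `x` to `y`, then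
counting copies of `w` does not shorten paths from `x` to `y`. -/
theorem dist_le_of_mem_weightedLengths {W : ℝ} (hw : 0 < w.len) {x y : S}
    (hprog : ∀ a : Γ, dist x (a • w.target) - dist y (a • w.target) -
      (dist x (a • w.source) - dist y (a • w.source)) ≤ 2 * (w.len - W)) {v : ℝ}
    (hv : v ∈ weightedLengths Γ w W x y) : dist x y ≤ v := by
  obtain ⟨α, hα1, hα2, rfl⟩ := hv
  obtain ⟨F, hcF, hF⟩ := exists_isCopyPacking_card_eq Γ hw α
  -- Length spent minus half the progress from `x` towards `y`. A copy spends `|w|` and progresses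
  -- by at most `|w| - W`, so `ψ` gains `W` over it; over all of `α` it gains `|α| - d(x, y)`.
  set ψ : ℝ → ℝ := fun t => t - (dist x (α.toFun t) - dist y (α.toFun t)) / 2 with hψ
  have hmono : MonotoneOn ψ (Set.Icc 0 α.len) := by
    intro s hs t ht hst
    have h0 := α.dist_le hs.1 hst ht.2
    have h1 := dist_triangle x (α.toFun s) (α.toFun t)
    have h2 := dist_triangle y (α.toFun t) (α.toFun s)
    rw [dist_comm (α.toFun t) (α.toFun s)] at h2
    simp only [hψ]
    linarith
  have h := card_mul_le_sub_of_monotoneOn (W := W) α.len_nonneg hmono w.len_nonneg F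
    (fun t ht => ⟨(hF.1 t ht).1, (hF.1 t ht).2.1⟩) hF.2 (fun t ht => by
      obtain ⟨-, -, a, ha⟩ := hF.1 t ht
      have h1 := ha 0 ⟨le_rfl, w.len_nonneg⟩
      have h2 := ha w.len ⟨w.len_nonneg, le_rfl⟩
      rw [add_zero] at h1
      have := hprog a
      simp only [ArcPath.target, ArcPath.source] at this
      simp only [hψ, h1, h2]
      linarith)
  have e0 : α.toFun 0 = x := hα1
  have e1 : α.toFun α.len = y := hα2
  simp only [hψ, e0, e1, dist_self, dist_comm y x, hcF] at h
  linarith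

variable [IsIsometricSMul Γ S]

/-- A path to `gᵐ x` followed by the `gᵐ`-translate of a path to `gⁿ x` contains at least the copies
of both. -/
theorem IsHyperbolicSpace.subadditive_sInf_weightedLengths {δ W : ℝ}
    (hS : IsHyperbolicSpace δ S) (hw : 0 < w.len) (hW0 : 0 ≤ W) (hW : W ≤ w.len) (g : Γ) (x : S) :
    Subadditive fun n : ℕ => sInf (weightedLengths Γ w W x (g ^ n • x)) := by
  intro m n
  rw [← sub_le_iff_le_add]
  refine le_csInf (hS.weightedLengths_nonempty ..) ?_
  rintro _ ⟨α, hα1, hα2, rfl⟩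
  rw [sub_le_iff_le_add, ← sub_le_iff_le_add']
  refine le_csInf (hS.weightedLengths_nonempty ..) ?_
  rintro _ ⟨β, hβ1, hβ2, rfl⟩
  have h : α.target = (β.translate (g ^ m)).source := by
    change _ = g ^ m • β.source
    rw [hα2, hβ1]
  have h1 : sInf (weightedLengths Γ w W x (g ^ (m + n) • x)) ≤
      (α.len + β.len) - W * copyCount Γ w (α.concat (β.translate (g ^ m)) h) := by
    refine csInf_le (bddBelow_weightedLengths hw hW _ _)
      ⟨α.concat (β.translate (g ^ m)) h, ?_, ?_, rfl⟩
    · rw [ArcPath.concat_source, hα1]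
    · rw [ArcPath.concat_target, pow_add, mul_smul, ← hβ2]
      rfl
  have h2 : (copyCount Γ w α + copyCount Γ w β : ℝ) ≤
      copyCount Γ w (α.concat (β.translate (g ^ m)) h) := by
    have := (Nat.add_le_add_left (copyCount_translate hw (g ^ m) β) _).trans
      (copyCount_add_le_concat (Γ := Γ) hw h)
    exact_mod_cast this
  have h3 := mul_le_mul_of_nonneg_left h2 hW0
  linarith

theorem IsHyperbolicSpace.exists_tendsto_sInf_weightedLengths_div {δ W : ℝ}
    (hS : IsHyperbolicSpace δ S) (hw : 0 < w.len) (hW0 : 0 ≤ W) (hW : W ≤ w.len) (g : Γ) (x : S) :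
    ∃ l, Tendsto (fun n : ℕ => sInf (weightedLengths Γ w W x (g ^ n • x)) / n) atTop (𝓝 l) :=
  ⟨_, (hS.subadditive_sInf_weightedLengths hw hW0 hW g x).tendsto_lim ⟨0, by
    rintro _ ⟨n, rfl⟩
    have : 0 ≤ sInf (weightedLengths Γ w W x (g ^ n • x)) :=
      Real.sInf_nonneg fun _ => nonneg_of_mem_weightedLengths hw hW
    positivity⟩⟩

end Counting

/-! ### The spectral gap -/

section Gap

variable {Γ : Type v} [Group Γ] {S : Type u} [MetricSpace S] [MulAction Γ S]
  [IsIsometricSMul Γ S]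

/-- A lower bound for the homogenization of an Epstein–Fujiwara function on `g`, for a word `w`
representing `g ^ M` whose reverse does not shorten paths along the orbit of `g`. -/
theorem IsHyperbolicSpace.tendsto_efFun_and_le {δ K τ : ℝ} (hS : IsHyperbolicSpace δ S)
    (hK : 0 < K) {g : Γ} {M : ℕ} (hM : 0 < M) {x : S} {w : ArcPath S}
    (hw : w.IsGeodesic x (g ^ M • x)) (hlong : 2 * K + 2 ≤ dist x (g ^ M • x))
    (hlo : ∀ n : ℕ, n * τ ≤ dist x (g ^ n • x)) (hup : dist x (g ^ M • x) ≤ M * τ + K)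
    (hprog : ∀ (P : ℕ) (a : Γ), dist x (a • x) - dist (g ^ P • x) (a • x) -
      (dist x (a • g ^ M • x) - dist (g ^ P • x) (a • g ^ M • x)) ≤
      2 * (dist x (g ^ M • x) - (K + 1))) :
    Tendsto (fun n : ℕ => efFun Γ w (K + 1) x (g ^ n) / n) atTop
        (𝓝 (homogenization (efFun Γ w (K + 1) x) g)) ∧
      1 / (M : ℝ) ≤ homogenization (efFun Γ w (K + 1) x) g := by
  have hl := hw.len_eq
  have hw0 : 0 < w.len := by linarith
  have hW : K + 1 ≤ w.len := by linarith
  have hrev : w.reverse.len = w.len := rfl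
  have hsub := hS.subadditive_sInf_weightedLengths (Γ := Γ) hw0 (by linarith) hW g x
  obtain ⟨l₁, h₁⟩ := hS.exists_tendsto_sInf_weightedLengths_div (w := w) hw0 (by linarith) hW g x
  obtain ⟨l₂, h₂⟩ := hS.exists_tendsto_sInf_weightedLengths_div (w := w.reverse) hw0
    (by linarith) hW g x
  have hlim : Tendsto (fun n : ℕ => efFun Γ w (K + 1) x (g ^ n) / n) atTop (𝓝 (l₂ - l₁)) :=
    (h₂.sub h₁).congr fun n => by rw [efFun_eq, sub_div]
  rw [homogenization, hlim.limUnder_eq]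
  refine ⟨hlim, ge_of_tendsto (hlim.comp (tendsto_id.nsmul_atTop hM)) ?_⟩
  filter_upwards [eventually_gt_atTop 0] with n hn
  have hn' : (0 : ℝ) < n := by exact_mod_cast hn
  have hM' : (0 : ℝ) < M := by exact_mod_cast hM
  simp only [Function.comp_apply, id, smul_eq_mul, Nat.cast_mul]
  -- The weight `K + 1` exceeds by one the additive error `K` in the length of `w`; this is the
  -- source of the gap.
  have hone : sInf (weightedLengths Γ w (K + 1) x (g ^ M • x)) ≤ M * τ - 1 := by
    have h1 : sInf (weightedLengths Γ w (K + 1) x (g ^ M • x)) ≤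
        w.len - (K + 1) * copyCount Γ w w :=
      csInf_le (bddBelow_weightedLengths hw0 hW _ _) ⟨w, hw.1, hw.2.1, rfl⟩
    have h2 : (1 : ℝ) ≤ copyCount Γ w w := by exact_mod_cast one_le_copyCount_self (Γ := Γ) hw0
    have h3 := mul_le_mul_of_nonneg_left h2 (by linarith : 0 ≤ K + 1)
    linarith
  have hmul : sInf (weightedLengths Γ w (K + 1) x (g ^ (M * n) • x)) ≤ n * (M * τ - 1) := by
    have : ∀ k : ℕ, 0 < k →
        sInf (weightedLengths Γ w (K + 1) x (g ^ (M * k) • x)) ≤ k * (M * τ - 1) := by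
      intro k hk
      induction k, hk using Nat.le_induction with
      | base => simpa using hone
      | succ k _ ih =>
        have := hsub (M * k) M
        simp only at this
        rw [Nat.mul_succ]
        push_cast
        linarith
    exact this n hn
  have hback : dist x (g ^ (M * n) • x) ≤
      sInf (weightedLengths Γ w.reverse (K + 1) x (g ^ (M * n) • x)) := by
    refine le_csInf (hS.weightedLengths_nonempty ..) fun v hv => ?_
    refine dist_le_of_mem_weightedLengths (w := w.reverse) hw0 (fun a => ?_) hv
    have ht : w.reverse.target = x := by
      rw [← hw.1]; simp [ArcPath.target, ArcPath.reverse, ArcPath.source]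
    have hs : w.reverse.source = g ^ M • x := by
      rw [← hw.2.1]; simp [ArcPath.target, ArcPath.reverse, ArcPath.source]
    rw [ht, hs, hrev, hl]
    exact hprog (M * n) a
  have hd := hlo (M * n)
  push_cast at hd
  rw [efFun_eq, div_le_div_iff₀ hM' (by positivity), one_mul, mul_comm (_ - _)]
  refine mul_le_mul_of_nonneg_left ?_ hM'.le
  linarith

end Gap

/-- Turns `τ ≥ 1 / N` into a number of steps, independent of `τ`, that covers the distance `c`. -/
theorem le_mul_ceil_mul {c τ : ℝ} {N : ℕ} (h : 1 ≤ N * τ) : c ≤ (N * ⌈c⌉₊ : ℕ) * τ := by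
  have h1 := Nat.le_ceil c
  have h2 := mul_le_mul_of_nonneg_left h (Nat.cast_nonneg (α := ℝ) ⌈c⌉₊)
  push_cast
  linarith

end AcylGap

end

-- The main theorem

universe u v

open AcylGap

theorem mainTheorem5 (δ : ℝ) (hδ : 0 < δ) :
    (∃ T K : ℝ, AdmissibleConstants.{u} δ T K) ∧
    ∀ T K : ℝ, AdmissibleConstants.{u} δ T K →
    ∀ (R : ℝ → ℝ) (N : ℝ → ℕ),
    ∃ M : ℕ, 0 < M ∧
      ∀ (S : Type u) [MetricSpace S] [Nonempty S] (Γ : Type v) [Group Γ]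
        [MulAction Γ S] [IsIsometricSMul Γ S],
        IsHyperbolicSpace δ S → IsAcylindricalWith Γ S R N →
        ∀ g : Γ, IsLoxodromic S g → IsChiral g →
          2 * K + 2 ≤ actionLength S (g ^ M) ∧
          ∀ x₀ : S, IsAlmostMinimal δ (fun z : S => g ^ M • z) x₀ →
          ∀ w : ArcPath S, w.IsGeodesic x₀ (g ^ M • x₀) →
            Tendsto (fun n : ℕ => efFun Γ w (K + 1) x₀ (g ^ n) / n) atTop
              (𝓝 (homogenization (efFun Γ w (K + 1) x₀) g)) ∧
            1 / (M : ℝ) ≤ homogenization (efFun Γ w (K + 1) x₀) g := by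
  refine ⟨exists_admissibleConstants hδ, fun T K h R N => ?_⟩
  have hK : 0 < K := h.2.1
  set e := 6 * δ with he
  set C := 2 * K + 4 * e with hC
  set N₀ := N (C + 1) with hN₀
  set r := 4 * (6 * (K + 1) + 4 * C + 2 * e) + e with hr
  set ρ := N₀ * ⌈R r⌉₊ with hρ
  set σ := N₀ * ⌈C + 4 * (K + 1) + e⌉₊ with hσ
  -- Besides the terms that exclude backward translates, `M` includes those making the translation
  -- length of `g ^ M` at least `2K + 2` and at least `T`.
  set M := 1 + ρ + N r + σ + N₀ * ⌈2 * K + 2⌉₊ + N₀ * ⌈T⌉₊ with hM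
  have hM0 : 0 < M := by omega
  refine ⟨M, hM0, fun S _ _ Γ _ _ _ hS hac g hg hchiral => ?_⟩
  set τ := actionLength S g with hτ
  have hτ0 : 0 < τ := hg
  have hN₀τ : 1 ≤ N₀ * τ := hac.one_le_mul_actionLength hδ h hS hg
  have hlarge : ∀ c : ℝ, N₀ * ⌈c⌉₊ ≤ M → c ≤ actionLength S (g ^ M) := fun c hc => by
    rw [actionLength_pow]
    refine (le_mul_ceil_mul hN₀τ).trans ?_
    gcongr
  have hlen : 2 * K + 2 ≤ actionLength S (g ^ M) := hlarge _ (by omega)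
  have hT : T ≤ actionLength S (g ^ M) := hlarge _ (by omega)
  refine ⟨hlen, fun x hx w hw => ?_⟩
  have hlo := mul_actionLength_le g x
  have hup := h.dist_pow_smul_le_of_pow hδ hS hT hx
  have hM1 : dist x (g ^ M • x) ≤ M * τ + K := by
    have := h.dist_pow_smul_le hS hT hx 1
    rwa [pow_one, Nat.cast_one, one_mul, actionLength_pow] at this
  have hlong : 2 * K + 2 ≤ dist x (g ^ M • x) := by
    have := hlo M
    rw [← actionLength_pow] at this
    linarith
  exact hS.tendsto_efFun_and_le hK hM0 hw hlong hlo hM1 fun P a =>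
    hac.progress_le_of_isChiral (hS.isFourPoint hδ.le) hchiral hτ0 hlo hup (by positivity)
      (by positivity) (by positivity) hr (ρ := ρ) (σ := σ) (le_mul_ceil_mul hN₀τ)
      (le_mul_ceil_mul hN₀τ) (by omega) P a
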